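/- The state $|GHZ_3\rangle=\frac{1}{\sqrt3}(|000\rangle+|111\rangle+|222\rangle)\in\mathbb C^3\otimes\mathbb C^3\otimes\mathbb C^3$, shared by three parties each holding one tensor factor, is a common resource of the three-qubit system: for every pure state (unit vector) $|\varphi\rangle\in\mathbb C^2\otimes\mathbb C^2\otimes\mathbb C^2$ there is a finite-round LOCC protocol (local operations and classical communication: in each round one party performs a measurement with finitely many outcomes, given by Kraus operators, on its own subsystem and announces the outcome, on which the later steps may depend) that transforms $|GHZ_3\rangle$ deterministically and exactly into $|\varphi\rangle$. -/

import Mathlib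

open scoped Kronecker

/-- The state space `ℂ^a ⊗ ℂ^b ⊗ ℂ^c` of a tripartite system shared by Alice, Bob and Charlie,
in coordinates with respect to the computational product basis. -/
abbrev TriSpace (a b c : ℕ) : Type := EuclideanSpace ℂ (Fin a × Fin b × Fin c)

/-- Operators (in particular density operators) on a tripartite system. -/
abbrev TriOp (a b c : ℕ) : Type := Matrix (Fin a × Fin b × Fin c) (Fin a × Fin b × Fin c) ℂ

/-- The set of pure states (unit vectors) of the system `a ⊗ b ⊗ c`. -/
def pureStates (a b c : ℕ) : Set (TriSpace a b c) := {ψ | ‖ψ‖ = 1}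

/-- The computational basis vector `|ijk⟩`. -/
noncomputable def ket {a b c : ℕ} (i : Fin a) (j : Fin b) (k : Fin c) : TriSpace a b c :=
  EuclideanSpace.single (i, j, k) 1

/-- The density operator `|ψ⟩⟨ψ|` of a pure state. -/
def densityOp {a b c : ℕ} (ψ : TriSpace a b c) : TriOp a b c :=
  Matrix.of fun x y => ψ x * star (ψ y)

/-- A quantum measurement with finitely many outcomes from a `d`-dimensional system to an
`m`-dimensional one: Kraus operators `M 0, …, M (n - 1)` with `∑ i, M i† M i = 1`. The case `n = 1`
covers unitary operations and isometric embeddings. -/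
def IsMeasurement {d m n : ℕ} (M : Fin n → Matrix (Fin m) (Fin d) ℂ) : Prop :=
  ∑ i, (M i).conjTranspose * M i = 1

/-- Finite-round LOCC protocols which lead from `a ⊗ b ⊗ c` to `a' ⊗ b' ⊗ c'`, where
`a' b' c'` are the first three arguments. A protocol either stops, or one of the parties measures
their own subsystem, announces the outcome to all the parties, and the protocol goes on in a way
that may depend on this outcome (and so on all previous ones). -/
inductive LOCCProtocol (a' b' c' : ℕ) : ℕ → ℕ → ℕ → Type
  | done : LOCCProtocol a' b' c' a' b' c'
  | alice {a b c m n : ℕ} (M : Fin n → Matrix (Fin m) (Fin a) ℂ) (hM : IsMeasurement M)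
      (next : Fin n → LOCCProtocol a' b' c' m b c) : LOCCProtocol a' b' c' a b c
  | bob {a b c m n : ℕ} (M : Fin n → Matrix (Fin m) (Fin b) ℂ) (hM : IsMeasurement M)
      (next : Fin n → LOCCProtocol a' b' c' a m c) : LOCCProtocol a' b' c' a b c
  | charlie {a b c m n : ℕ} (M : Fin n → Matrix (Fin m) (Fin c) ℂ) (hM : IsMeasurement M)
      (next : Fin n → LOCCProtocol a' b' c' a b m) : LOCCProtocol a' b' c' a b c

/-- The quantum channel which an LOCC protocol implements: on outcome `i` the (unnormalized)
operator `ρ` becomes `K ρ K†` with `K` the Kraus operator `M i` acting on one party's factor, and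
the final operator is the sum over all the branches. -/
noncomputable def LOCCProtocol.apply {a' b' c' : ℕ} :
    {a b c : ℕ} → LOCCProtocol a' b' c' a b c → TriOp a b c → TriOp a' b' c'
  | _, _, _, .done, ρ => ρ
  | _, b, c, .alice M _ next, ρ =>
      ∑ i, (next i).apply
        ((M i ⊗ₖ ((1 : Matrix (Fin b) (Fin b) ℂ) ⊗ₖ (1 : Matrix (Fin c) (Fin c) ℂ))) * ρ *
          (M i ⊗ₖ ((1 : Matrix (Fin b) (Fin b) ℂ) ⊗ₖ (1 : Matrix (Fin c) (Fin c) ℂ))).conjTranspose)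
  | a, _, c, .bob M _ next, ρ =>
      ∑ i, (next i).apply
        (((1 : Matrix (Fin a) (Fin a) ℂ) ⊗ₖ (M i ⊗ₖ (1 : Matrix (Fin c) (Fin c) ℂ))) * ρ *
          ((1 : Matrix (Fin a) (Fin a) ℂ) ⊗ₖ (M i ⊗ₖ (1 : Matrix (Fin c) (Fin c) ℂ))).conjTranspose)
  | a, b, _, .charlie M _ next, ρ =>
      ∑ i, (next i).apply
        (((1 : Matrix (Fin a) (Fin a) ℂ) ⊗ₖ ((1 : Matrix (Fin b) (Fin b) ℂ) ⊗ₖ M i)) * ρ *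
          ((1 : Matrix (Fin a) (Fin a) ℂ) ⊗ₖ ((1 : Matrix (Fin b) (Fin b) ℂ) ⊗ₖ M i)).conjTranspose)

/-- `ψ` can be transformed into `φ` by LOCC (deterministically and exactly): some finite-round LOCC
protocol maps `|ψ⟩⟨ψ|` to `|φ⟩⟨φ|`. -/
def LOCCConvertible {a b c a' b' c' : ℕ} (ψ : TriSpace a b c) (φ : TriSpace a' b' c') : Prop :=
  ∃ P : LOCCProtocol a' b' c' a b c, P.apply (densityOp ψ) = densityOp φ

/-- `ψ` is a common resource for the set `S` of states: it is a pure state that can be transformed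
by LOCC into every state in `S`. -/
def IsCommonResource {a b c a' b' c' : ℕ} (ψ : TriSpace a b c) (S : Set (TriSpace a' b' c')) :
    Prop :=
  ψ ∈ pureStates a b c ∧ ∀ φ ∈ S, LOCCConvertible ψ φ

/-- The state `(|000⟩ + |111⟩ + |222⟩) / √3` of the system `3 ⊗ 3 ⊗ 3`. -/
noncomputable def ghz₃ : TriSpace 3 3 3 :=
  ((1 / √3 : ℝ) : ℂ) • (ket 0 0 0 + ket 1 1 1 + ket 2 2 2)

/-! Slice `φ` along Charlie's qubit into two 2 × 2 matrices. The determinant is quadratic on their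
span, so over `ℂ` a rotation of that qubit makes one slice singular, `q₀ u ⊗ v`. A singular value
decomposition of the other slice gives three product terms, `φ = U_C (q₀ u v |0⟩ + (q₁ V₀ W₀ + q₂ V₁
W₁) |1⟩)`, which are orthonormal, so `∑ |q r|² = 1` (`exists_consCol_decomposition`,
`sum_star_consCol_decomposition`).

The protocol in `locc_of_decomposition` turns GHZ into `∑ q r |rrr⟩`, merges Charlie's levels 1 and
2, and lets Alice and Bob send `|r⟩` to the columns of `(u, V₀, V₁)` and `(v, W₀, W₁)`. These maps
are not isometries; each is measured along with sign-flipped variants, whose cross terms cancel on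
summing. The other parties undo the announced sign or shift, so all branches agree. -/

/-- The vector `∑ r, X r ⊗ Y r ⊗ Z r`, where `X r`, `Y r`, `Z r` are the columns of the matrices. -/
noncomputable def tri {a b c d : ℕ} (X : Matrix (Fin a) (Fin d) ℂ) (Y : Matrix (Fin b) (Fin d) ℂ)
    (Z : Matrix (Fin c) (Fin d) ℂ) : TriSpace a b c :=
  WithLp.toLp 2 fun x => ∑ r, X x.1 r * Y x.2.1 r * Z x.2.2 r

/-! ### Protocol rounds with equally likely branches -/

theorem LOCCProtocol.apply_smul {a b c a' b' c' : ℕ} (P : LOCCProtocol a' b' c' a b c) (t : ℂ)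
    (ρ : TriOp a b c) : P.apply (t • ρ) = t • P.apply ρ := by
  induction P with
  | done => simp [LOCCProtocol.apply]
  | alice M hM next ih => simp [LOCCProtocol.apply, Finset.smul_sum, ih]
  | bob M hM next ih => simp [LOCCProtocol.apply, Finset.smul_sum, ih]
  | charlie M hM next ih => simp [LOCCProtocol.apply, Finset.smul_sum, ih]

theorem isMeasurement_smul {d m n : ℕ} [NeZero n] {N : Fin n → Matrix (Fin m) (Fin d) ℂ}
    (hN : ∑ i, (N i).conjTranspose * N i = (n : ℂ) • 1) :
    IsMeasurement fun i => ((1 / √n : ℝ) : ℂ) • N i := by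
  have hn : (0 : ℝ) < n := by exact_mod_cast Nat.pos_of_ne_zero (NeZero.ne n)
  have h : ((1 / √n : ℝ) : ℂ) * ((1 / √n : ℝ) : ℂ) * n = 1 := by
    norm_cast
    field_simp
    rw [Real.sq_sqrt hn.le]
  simp only [IsMeasurement, Matrix.conjTranspose_smul, Matrix.smul_mul, Matrix.mul_smul, smul_smul,
    ← Finset.smul_sum, hN]
  simpa using congrArg (· • (1 : Matrix (Fin d) (Fin d) ℂ)) h

theorem smul_mul_densityOp_mul {a b c a' b' c' : ℕ} (n : ℕ) (ψ : TriSpace a b c)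
    (K : Matrix (Fin a' × Fin b' × Fin c') (Fin a × Fin b × Fin c) ℂ) :
    (((1 / √n : ℝ) : ℂ) • K) * densityOp ψ * (((1 / √n : ℝ) : ℂ) • K).conjTranspose =
      (1 / n : ℂ) • densityOp (WithLp.toLp 2 (K.mulVec ψ) : TriSpace a' b' c') := by
  have h : ((1 / √n : ℝ) : ℂ) * ((1 / √n : ℝ) : ℂ) = 1 / n := by
    rw [← Complex.ofReal_mul, div_mul_div_comm, Real.mul_self_sqrt n.cast_nonneg]
    simp
  have h1 : ∀ {x y z : ℕ} (χ : TriSpace x y z), densityOp χ = Matrix.vecMulVec χ (star χ.ofLp) := by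
    intros; rfl
  rw [h1, h1, Matrix.conjTranspose_smul, Matrix.smul_mul, Matrix.mul_smul, Matrix.smul_mul,
    smul_smul, Matrix.mul_vecMulVec, Matrix.vecMulVec_mul, Matrix.star_mulVec]
  simp only [Complex.star_def, Complex.conj_ofReal, h]

theorem sum_one_div_smul {E : Type*} [AddCommGroup E] [Module ℂ E] (n : ℕ) [NeZero n] (x : E) :
    ∑ _i : Fin n, (1 / n : ℂ) • x = x := by
  have hn : (n : ℂ) ≠ 0 := by exact_mod_cast NeZero.ne n
  rw [← Finset.sum_smul]
  simp [hn]

section steps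

variable {a b c d m n a' b' c' : ℕ} [NeZero n] {X : Matrix (Fin a) (Fin d) ℂ}
  {Y : Matrix (Fin b) (Fin d) ℂ} {Z : Matrix (Fin c) (Fin d) ℂ} {φ : TriSpace a' b' c'}

theorem kronecker_alice_mulVec_tri (N : Matrix (Fin m) (Fin a) ℂ) :
    (N ⊗ₖ ((1 : Matrix (Fin b) (Fin b) ℂ) ⊗ₖ (1 : Matrix (Fin c) (Fin c) ℂ))).mulVec (tri X Y Z) =
      tri (N * X) Y Z := by
  ext ⟨i, j, k⟩
  simp only [tri, Matrix.mulVec, dotProduct, Fintype.sum_prod_type, Matrix.kroneckerMap_apply,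
    Matrix.one_apply, Matrix.mul_apply, mul_ite, ite_mul, mul_one, mul_zero, zero_mul,
    Finset.mul_sum, Finset.sum_mul]
  simp only [mul_assoc]
  rw [Finset.sum_comm]
  simp
  exact Finset.sum_comm

theorem kronecker_bob_mulVec_tri (N : Matrix (Fin m) (Fin b) ℂ) :
    ((1 : Matrix (Fin a) (Fin a) ℂ) ⊗ₖ (N ⊗ₖ (1 : Matrix (Fin c) (Fin c) ℂ))).mulVec (tri X Y Z) =
      tri X (N * Y) Z := by
  ext ⟨i, j, k⟩
  simp only [tri, Matrix.mulVec, dotProduct, Fintype.sum_prod_type, Matrix.kroneckerMap_apply,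
    Matrix.one_apply, Matrix.mul_apply, mul_ite, ite_mul, mul_zero, zero_mul, one_mul,
    Finset.sum_ite_eq, Finset.sum_ite_irrel, Finset.sum_const_zero,
    Finset.mem_univ, if_true, Finset.mul_sum, Finset.sum_mul]
  rw [Finset.sum_comm]
  simp [mul_assoc, mul_left_comm]

theorem kronecker_charlie_mulVec_tri (N : Matrix (Fin m) (Fin c) ℂ) :
    ((1 : Matrix (Fin a) (Fin a) ℂ) ⊗ₖ ((1 : Matrix (Fin b) (Fin b) ℂ) ⊗ₖ N)).mulVec (tri X Y Z) =
      tri X Y (N * Z) := by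
  ext ⟨i, j, k⟩
  simp only [tri, Matrix.mulVec, dotProduct, Fintype.sum_prod_type, Matrix.kroneckerMap_apply,
    Matrix.one_apply, Matrix.mul_apply, mul_ite, ite_mul, mul_zero, zero_mul, one_mul,
    Finset.sum_ite_eq, Finset.sum_ite_irrel, Finset.sum_const_zero,
    Finset.mem_univ, if_true, Finset.mul_sum]
  rw [Finset.sum_comm]
  simp [mul_assoc, mul_left_comm]

/-- The Kraus operators are `N i / √n`, so once every branch is continued to `φ` it contributes
`1/n` of `|φ⟩⟨φ|`. Normalizing the sum to `n` keeps these scalars out of the vectors. -/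
theorem LOCCConvertible.alice (N : Fin n → Matrix (Fin m) (Fin a) ℂ)
    (hN : ∑ i, (N i).conjTranspose * N i = (n : ℂ) • 1)
    (h : ∀ i, LOCCConvertible (tri (N i * X) Y Z) φ) : LOCCConvertible (tri X Y Z) φ := by
  choose P hP using h
  refine ⟨.alice _ (isMeasurement_smul hN) P, ?_⟩
  simp only [LOCCProtocol.apply, Matrix.smul_kronecker, smul_mul_densityOp_mul,
    kronecker_alice_mulVec_tri, LOCCProtocol.apply_smul, WithLp.toLp_ofLp, hP, sum_one_div_smul]

theorem LOCCConvertible.bob (N : Fin n → Matrix (Fin m) (Fin b) ℂ)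
    (hN : ∑ i, (N i).conjTranspose * N i = (n : ℂ) • 1)
    (h : ∀ i, LOCCConvertible (tri X (N i * Y) Z) φ) : LOCCConvertible (tri X Y Z) φ := by
  choose P hP using h
  refine ⟨.bob _ (isMeasurement_smul hN) P, ?_⟩
  simp only [LOCCProtocol.apply, Matrix.smul_kronecker, Matrix.kronecker_smul,
    smul_mul_densityOp_mul,
    kronecker_bob_mulVec_tri, LOCCProtocol.apply_smul, WithLp.toLp_ofLp, hP, sum_one_div_smul]

theorem LOCCConvertible.charlie (N : Fin n → Matrix (Fin m) (Fin c) ℂ)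
    (hN : ∑ i, (N i).conjTranspose * N i = (n : ℂ) • 1)
    (h : ∀ i, LOCCConvertible (tri X Y (N i * Z)) φ) : LOCCConvertible (tri X Y Z) φ := by
  choose P hP using h
  refine ⟨.charlie _ (isMeasurement_smul hN) P, ?_⟩
  simp only [LOCCProtocol.apply, Matrix.kronecker_smul, smul_mul_densityOp_mul,
    kronecker_charlie_mulVec_tri, LOCCProtocol.apply_smul, WithLp.toLp_ofLp, hP, sum_one_div_smul]

theorem LOCCConvertible.bob_unitary (U : Matrix (Fin b) (Fin b) ℂ) (hU : U.conjTranspose * U = 1)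
    (h : LOCCConvertible (tri X (U * Y) Z) φ) : LOCCConvertible (tri X Y Z) φ :=
  .bob (n := 1) (fun _ => U) (by simpa using hU) fun _ => h

theorem LOCCConvertible.charlie_unitary (U : Matrix (Fin c) (Fin c) ℂ)
    (hU : U.conjTranspose * U = 1)
    (h : LOCCConvertible (tri X Y (U * Z)) φ) : LOCCConvertible (tri X Y Z) φ :=
  .charlie (n := 1) (fun _ => U) (by simpa using hU) fun _ => h

end steps

theorem LOCCConvertible.refl {a b c : ℕ} (φ : TriSpace a b c) : LOCCConvertible φ φ :=
  ⟨.done, rfl⟩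

/-! ### Linear algebra of 2 × 2 matrices -/

theorem exists_eq_smul_unit (x : Fin 2 → ℂ) :
    ∃ (t : ℂ) (u : Fin 2 → ℂ), star u ⬝ᵥ u = 1 ∧ x = t • u := by
  by_cases hx : x = 0
  · exact ⟨0, ![1, 0], by simp [dotProduct], by simp [hx]⟩
  · set v : EuclideanSpace ℂ (Fin 2) := WithLp.toLp 2 x with hv
    have hv0 : ‖v‖ ≠ 0 := by simpa [hv] using hx
    have hc : (‖v‖ : ℂ) ≠ 0 := by exact_mod_cast hv0
    have hn : star x ⬝ᵥ x = (‖v‖ : ℂ) ^ 2 := by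
      have := inner_self_eq_norm_sq_to_K (𝕜 := ℂ) v
      rw [EuclideanSpace.inner_eq_star_dotProduct] at this
      simpa [hv, dotProduct_comm] using this
    refine ⟨‖v‖, (‖v‖ : ℂ)⁻¹ • x, ?_, by simp [smul_smul, hc]⟩
    simp only [star_smul, smul_dotProduct, dotProduct_smul, hn, smul_eq_mul]
    simp
    field_simp

/-- The unitary matrix with first column `u`, for a unit vector `u`. -/
def unitaryOfUnit (u : Fin 2 → ℂ) : Matrix (Fin 2) (Fin 2) ℂ :=
  !![u 0, -star (u 1); u 1, star (u 0)]

theorem unitaryOfUnit_conjTranspose_mul_self {u : Fin 2 → ℂ} (hu : star u ⬝ᵥ u = 1) :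
    (unitaryOfUnit u).conjTranspose * unitaryOfUnit u = 1 := by
  simp only [dotProduct, Fin.sum_univ_two, Pi.star_apply] at hu
  ext i j
  fin_cases i <;> fin_cases j <;>
    simp [unitaryOfUnit, Matrix.mul_apply, Fin.sum_univ_two] <;> simp at hu
  · linear_combination hu
  · ring
  · ring
  · linear_combination hu

theorem exists_unitary_of_dotProduct_eq_zero {x y : Fin 2 → ℂ} (h : star x ⬝ᵥ y = 0) :
    ∃ (V : Matrix (Fin 2) (Fin 2) ℂ) (s t : ℂ), V.conjTranspose * V = 1 ∧
      (∀ i, x i = V i 0 * s) ∧ ∀ i, y i = V i 1 * t := by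
  by_cases hx : x = 0
  · obtain ⟨t, u, hu, rfl⟩ := exists_eq_smul_unit y
    -- This unit vector is chosen so that the second column of its unitary is `u`.
    have hu' : star ![star (u 1), -star (u 0)] ⬝ᵥ ![star (u 1), -star (u 0)] = 1 := by
      simp only [dotProduct, Fin.sum_univ_two, Pi.star_apply] at hu ⊢
      simp at hu ⊢
      linear_combination hu
    refine ⟨_, 0, t, unitaryOfUnit_conjTranspose_mul_self hu', by simp [hx], fun i => ?_⟩
    fin_cases i <;> simp [unitaryOfUnit, mul_comm]
  · obtain ⟨s, u, hu, rfl⟩ := exists_eq_smul_unit x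
    have hs : s ≠ 0 := fun h0 => hx (by simp [h0])
    have h' : star u ⬝ᵥ y = 0 := by simpa [hs, star_smul, smul_dotProduct] using h
    refine ⟨_, s, u 0 * y 1 - u 1 * y 0, unitaryOfUnit_conjTranspose_mul_self hu,
      fun i => ?_, fun i => ?_⟩
    · fin_cases i <;> simp [unitaryOfUnit, mul_comm]
    · simp only [dotProduct, Fin.sum_univ_two, Pi.star_apply] at hu h'
      simp at hu h'
      fin_cases i <;> simp [unitaryOfUnit]
      · linear_combination (-y 0) * hu + u 0 * h'
      · linear_combination (-y 1) * hu + u 1 * h'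

/-- An eigenbasis `W₀` of `M† M` makes the columns of `M W₀` orthogonal, hence multiples of the
columns of a unitary `V`. Expanding `M = (M W₀) W₀†` conjugates the entries of `W₀`. -/
theorem exists_singular_value_decomposition (M : Matrix (Fin 2) (Fin 2) ℂ) :
    ∃ (V W : Matrix (Fin 2) (Fin 2) ℂ) (s t : ℂ), V.conjTranspose * V = 1 ∧
      W.conjTranspose * W = 1 ∧ ∀ i j, M i j = s * V i 0 * W j 0 + t * V i 1 * W j 1 := by
  have hM : (M.conjTranspose * M).IsHermitian := Matrix.isHermitian_conjTranspose_mul_self M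
  set W₀ : Matrix (Fin 2) (Fin 2) ℂ := ↑hM.eigenvectorUnitary with hW₀
  have h1 : W₀.conjTranspose * W₀ = 1 := by
    simpa [Matrix.star_eq_conjTranspose] using Unitary.coe_star_mul_self hM.eigenvectorUnitary
  have h2 : W₀ * W₀.conjTranspose = 1 := mul_eq_one_comm.1 h1
  have hD : (M * W₀).conjTranspose * (M * W₀) =
      Matrix.diagonal (fun i => (hM.eigenvalues i : ℂ)) := by
    have h := hM.conjStarAlgAut_star_eigenvectorUnitary
    rw [Unitary.conjStarAlgAut_apply] at h
    simpa [Matrix.conjTranspose_mul, Matrix.mul_assoc, Matrix.star_eq_conjTranspose,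
      Function.comp_def] using h
  have h01 : star (fun i => (M * W₀) i 0) ⬝ᵥ (fun i => (M * W₀) i 1) = 0 := by
    have h := congrFun (congrFun hD 0) 1
    rwa [Matrix.mul_apply, Matrix.diagonal_apply_ne _ zero_ne_one] at h
  obtain ⟨V, s, t, hV, hs, ht⟩ := exists_unitary_of_dotProduct_eq_zero h01
  refine ⟨V, W₀.map star, s, t, hV, ?_, fun i j => ?_⟩
  · have h := congrArg Matrix.transpose h1
    rw [Matrix.transpose_mul, Matrix.transpose_one] at h
    rwa [show (W₀.map star).conjTranspose = W₀.transpose by ext; simp]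
  · have : M = M * W₀ * W₀.conjTranspose := by rw [Matrix.mul_assoc, h2, Matrix.mul_one]
    rw [this, Matrix.mul_apply, Fin.sum_univ_two, hs, ht]
    simp
    ring

theorem exists_rank_one_of_det_eq_zero {M : Matrix (Fin 2) (Fin 2) ℂ} (h : M.det = 0) :
    ∃ (a b : Fin 2 → ℂ) (t : ℂ), star a ⬝ᵥ a = 1 ∧ star b ⬝ᵥ b = 1 ∧
      ∀ i j, M i j = t * a i * b j := by
  obtain ⟨x, hx0, hx⟩ := Matrix.exists_mulVec_eq_zero_iff.2 h
  obtain ⟨s, u, hu, rfl⟩ := exists_eq_smul_unit x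
  have hs : s ≠ 0 := fun h0 => hx0 (by simp [h0])
  have hMu : M.mulVec u = 0 := by simpa [Matrix.mulVec_smul, hs] using hx
  -- `M` kills the unit vector `u`, so it is determined by its value on the orthogonal vector
  -- `(-star (u 1), star (u 0))`.
  obtain ⟨t, a, ha, hta⟩ := exists_eq_smul_unit (fun i => M i 1 * star (u 0) - M i 0 * star (u 1))
  simp only [dotProduct, Fin.sum_univ_two, Pi.star_apply] at hu
  simp at hu
  refine ⟨a, ![-u 1, u 0], t, ha, ?_, fun i j => ?_⟩
  · simp [dotProduct]
    linear_combination hu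
  · have hi := congrFun hMu i
    have hai := congrFun hta i
    simp [Matrix.mulVec, dotProduct] at hi hai
    fin_cases j <;> simp [← hai]
    · linear_combination (-M i 0) * hu + starRingEnd ℂ (u 0) * hi
    · linear_combination (-M i 1) * hu + starRingEnd ℂ (u 1) * hi

theorem exists_unit_det_eq_zero (M N : Matrix (Fin 2) (Fin 2) ℂ) :
    ∃ u : Fin 2 → ℂ, star u ⬝ᵥ u = 1 ∧ (u 0 • M + u 1 • N).det = 0 := by
  obtain ⟨x, hx, h⟩ : ∃ x : Fin 2 → ℂ, x ≠ 0 ∧ (x 0 • M + x 1 • N).det = 0 := by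
    by_cases hN : N.det = 0
    · exact ⟨![0, 1], by simp, by simpa using hN⟩
    -- A root of `det (M + z N)`, which has leading coefficient `det N`.
    · obtain ⟨z, hz⟩ := exists_quadratic_eq_zero (a := N.det)
        (b := M 0 0 * N 1 1 + N 0 0 * M 1 1 - M 0 1 * N 1 0 - N 0 1 * M 1 0) (c := M.det) hN
        ((IsAlgClosed.exists_pow_nat_eq _ two_pos).imp fun s hs => hs.symm.trans (sq s))
      refine ⟨![1, z], by simp, ?_⟩
      simp only [Matrix.det_fin_two] at hz ⊢
      simp
      linear_combination hz
  obtain ⟨s, u, hu, rfl⟩ := exists_eq_smul_unit x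
  have hs : s ≠ 0 := fun h0 => hx (by simp [h0])
  refine ⟨u, hu, ?_⟩
  simpa [← smul_smul, ← smul_add, Matrix.det_smul, hs] using h

theorem sum_star_tri_mul_tri {a b c d : ℕ} (X : Matrix (Fin a) (Fin d) ℂ)
    (Y : Matrix (Fin b) (Fin d) ℂ) (Z : Matrix (Fin c) (Fin d) ℂ) :
    ∑ x, star (tri X Y Z x) * tri X Y Z x = ∑ r, ∑ s, (X.conjTranspose * X) r s *
      (Y.conjTranspose * Y) r s * (Z.conjTranspose * Z) r s := by
  simp only [tri, star_sum, Finset.sum_mul_sum]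
  rw [Finset.sum_comm]
  refine Finset.sum_congr rfl fun r _ => ?_
  rw [Finset.sum_comm]
  refine Finset.sum_congr rfl fun s _ => ?_
  rw [Matrix.mul_apply, Matrix.mul_apply, Matrix.mul_apply, mul_assoc, Finset.sum_mul_sum,
    Finset.sum_mul_sum]
  simp only [Fintype.sum_prod_type, Finset.mul_sum, Matrix.conjTranspose_apply, star_mul']
  refine Finset.sum_congr rfl fun i _ => Finset.sum_congr rfl fun j _ =>
    Finset.sum_congr rfl fun k _ => ?_
  ring

/-! ### Three-term decomposition of a three-qubit state -/

/-- The matrix `diag(±1, 1, 1)`. -/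
def headSign (i : Fin 2) : Matrix (Fin 3) (Fin 3) ℂ := Matrix.diagonal ![(-1) ^ (i : ℕ), 1, 1]

/-- The matrix `diag(1, 1, ±1)`. -/
def lastSign (i : Fin 2) : Matrix (Fin 3) (Fin 3) ℂ := Matrix.diagonal ![1, 1, (-1) ^ (i : ℕ)]

/-- The matrix `diag(±1, 1)`. -/
def qubitSign (i : Fin 2) : Matrix (Fin 2) (Fin 2) ℂ := Matrix.diagonal ![(-1) ^ (i : ℕ), 1]

/-- The matrix `|0⟩⟨0| + |1⟩(⟨1| ± ⟨2|)`. -/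
def mergeMatrix (i : Fin 2) : Matrix (Fin 2) (Fin 3) ℂ := !![1, 0, 0; 0, 1, (-1) ^ (i : ℕ)]

theorem lastSign_conjTranspose_mul_self (i : Fin 2) :
    (lastSign i).conjTranspose * lastSign i = 1 := by
  rw [lastSign, Matrix.diagonal_conjTranspose, Matrix.diagonal_mul_diagonal, ← Matrix.diagonal_one]
  congr 1
  ext r
  fin_cases r <;> fin_cases i <;> simp

theorem qubitSign_conjTranspose_mul_self (i : Fin 2) :
    (qubitSign i).conjTranspose * qubitSign i = 1 := by
  rw [qubitSign, Matrix.diagonal_conjTranspose, Matrix.diagonal_mul_diagonal,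
    ← Matrix.diagonal_one]
  congr 1
  ext r
  fin_cases r <;> fin_cases i <;> simp

theorem sum_mergeMatrix :
    ∑ i, (mergeMatrix i).conjTranspose * mergeMatrix i = ((2 : ℕ) : ℂ) • 1 := by
  ext r s
  fin_cases r <;> fin_cases s <;>
    simp [mergeMatrix, Matrix.mul_apply, Fin.sum_univ_two, one_add_one_eq_two]

/-- The `2 × 3` matrix with columns `u`, `V 0`, `V 1`. -/
def consCol (u : Fin 2 → ℂ) (V : Matrix (Fin 2) (Fin 2) ℂ) : Matrix (Fin 2) (Fin 3) ℂ :=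
  Matrix.of fun i r => ![u i, V i 0, V i 1] r

theorem exists_consCol_decomposition (φ : TriSpace 2 2 2) :
    ∃ (u v : Fin 2 → ℂ) (V W U : Matrix (Fin 2) (Fin 2) ℂ) (q : Fin 3 → ℂ),
      star u ⬝ᵥ u = 1 ∧ star v ⬝ᵥ v = 1 ∧ V.conjTranspose * V = 1 ∧ W.conjTranspose * W = 1 ∧
      U.conjTranspose * U = 1 ∧
      φ = tri (consCol u V * Matrix.diagonal q) (consCol v W) (U * mergeMatrix 0) := by
  obtain ⟨x, hx, hdet⟩ := exists_unit_det_eq_zero (Matrix.of fun i j => φ (i, j, 0))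
    (Matrix.of fun i j => φ (i, j, 1))
  obtain ⟨u, v, q₀, hu, hv, h₀⟩ := exists_rank_one_of_det_eq_zero hdet
  obtain ⟨V, W, q₁, q₂, hV, hW, h₁⟩ := exists_singular_value_decomposition
    (-star (x 1) • Matrix.of (fun i j => φ (i, j, 0)) +
      star (x 0) • Matrix.of fun i j => φ (i, j, 1))
  have hx' : star (star x) ⬝ᵥ star x = 1 := by rwa [star_star, dotProduct_comm]
  -- The new slices come from the old by the rows `x` and `(-star (x 1), star (x 0))`; the adjoint
  -- of that unitary inverts this.
  refine ⟨u, v, V, W, unitaryOfUnit (star x), ![q₀, q₁, q₂], hu, hv, hV, hW,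
    unitaryOfUnit_conjTranspose_mul_self hx', ?_⟩
  simp only [dotProduct, Fin.sum_univ_two, Pi.star_apply] at hx
  ext ⟨i, j, k⟩
  have h₀ := h₀ i j
  have h₁ := h₁ i j
  simp at hx h₀ h₁
  fin_cases k <;>
    simp [tri, Fin.sum_univ_three, consCol, Matrix.mul_diagonal, unitaryOfUnit, mergeMatrix,
      Matrix.mul_apply (M := !![_, _; _, _])]
  · linear_combination (-φ (i, j, 0)) * hx + starRingEnd ℂ (x 0) * h₀ - x 1 * h₁
  · linear_combination (-φ (i, j, 1)) * hx + starRingEnd ℂ (x 1) * h₀ + x 0 * h₁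

theorem consCol_gram_zero {u : Fin 2 → ℂ} (V : Matrix (Fin 2) (Fin 2) ℂ) (hu : star u ⬝ᵥ u = 1) :
    ((consCol u V).conjTranspose * consCol u V) 0 0 = 1 :=
  hu

theorem consCol_gram_succ (u : Fin 2 → ℂ) {V : Matrix (Fin 2) (Fin 2) ℂ}
    (hV : V.conjTranspose * V = 1) (i j : Fin 2) :
    ((consCol u V).conjTranspose * consCol u V) i.succ j.succ = if i = j then 1 else 0 := by
  rw [← Matrix.one_apply, ← hV]
  fin_cases i <;> fin_cases j <;> rfl

theorem gram_mul_diagonal {d m : ℕ} (A : Matrix (Fin m) (Fin d) ℂ) (q : Fin d → ℂ) (r s : Fin d) :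
    ((A * Matrix.diagonal q).conjTranspose * (A * Matrix.diagonal q)) r s =
      star (q r) * (A.conjTranspose * A) r s * q s := by
  rw [Matrix.conjTranspose_mul, Matrix.diagonal_conjTranspose, Matrix.mul_assoc,
    ← Matrix.mul_assoc A.conjTranspose, Matrix.diagonal_mul, Matrix.mul_diagonal, mul_assoc]
  rfl

/-- Summing over the sign cancels the inner products of the first column with the other two, which
are orthonormal. -/
theorem sum_headSign_consCol {u : Fin 2 → ℂ} {V : Matrix (Fin 2) (Fin 2) ℂ}
    (hu : star u ⬝ᵥ u = 1) (hV : V.conjTranspose * V = 1) :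
    ∑ i, (consCol u V * headSign i).conjTranspose * (consCol u V * headSign i) =
      ((2 : ℕ) : ℂ) • 1 := by
  have h0 := consCol_gram_zero V hu
  have h := consCol_gram_succ u hV
  have h11 := h 0 0
  have h12 := h 0 1
  have h21 := h 1 0
  have h22 := h 1 1
  simp only [Fin.succ_zero_eq_one, Fin.succ_one_eq_two] at h11 h12 h21 h22
  ext r s
  rw [Matrix.sum_apply]
  simp only [headSign, gram_mul_diagonal, Fin.sum_univ_two]
  fin_cases r <;> fin_cases s <;> simp [h0, h11, h12, h21, h22, one_add_one_eq_two]

theorem sum_star_consCol_decomposition {u v : Fin 2 → ℂ} {V W U : Matrix (Fin 2) (Fin 2) ℂ}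
    (q : Fin 3 → ℂ) (hu : star u ⬝ᵥ u = 1) (hv : star v ⬝ᵥ v = 1) (hV : V.conjTranspose * V = 1)
    (hW : W.conjTranspose * W = 1) (hU : U.conjTranspose * U = 1) {φ : TriSpace 2 2 2}
    (hφ : φ = tri (consCol u V * Matrix.diagonal q) (consCol v W) (U * mergeMatrix 0)) :
    ∑ x, star (φ x) * φ x = ∑ r, star (q r) * q r := by
  have hV0 := consCol_gram_zero V hu
  have hV' := consCol_gram_succ u hV
  have hV11 := hV' 0 0
  have hV12 := hV' 0 1
  have hV21 := hV' 1 0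
  have hV22 := hV' 1 1
  have hW0 := consCol_gram_zero W hv
  have hW' := consCol_gram_succ v hW
  have hW11 := hW' 0 0
  have hW22 := hW' 1 1
  have hC : (U * mergeMatrix 0).conjTranspose * (U * mergeMatrix 0) =
      !![1, 0, 0; 0, 1, 1; 0, 1, 1] := by
    rw [Matrix.conjTranspose_mul, Matrix.mul_assoc, ← Matrix.mul_assoc U.conjTranspose, hU,
      Matrix.one_mul]
    ext r s
    fin_cases r <;> fin_cases s <;> simp [mergeMatrix, Matrix.mul_apply, Fin.sum_univ_two]
  simp only [Fin.succ_zero_eq_one, Fin.succ_one_eq_two] at hV11 hV12 hV21 hV22 hW11 hW22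
  -- Charlie's Gram matrix kills the cross terms with index 0, and orthogonality in `V` those
  -- between 1 and 2.
  rw [hφ, sum_star_tri_mul_tri, hC]
  simp only [gram_mul_diagonal, Fin.sum_univ_three]
  simp [hV0, hV11, hV12, hV21, hV22, hW0, hW11, hW22]

/-! ### The protocol -/

/-- The permutation matrix of the cyclic shift by `k`. -/
def shiftMatrix (k : Fin 3) : Matrix (Fin 3) (Fin 3) ℂ :=
  Matrix.of fun i j => if j = i + k then 1 else 0

theorem shiftMatrix_conjTranspose_mul_self (k : Fin 3) :
    (shiftMatrix k).conjTranspose * shiftMatrix k = 1 := by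
  ext r s
  fin_cases k <;> fin_cases r <;> fin_cases s <;>
    simp [shiftMatrix, Matrix.mul_apply, Fin.sum_univ_three]

/-- Each diagonal entry collects every `|q i|²` once over the three shifts. -/
theorem sum_diagonal_mul_shiftMatrix {q : Fin 3 → ℂ} (hq : ∑ i, star (q i) * q i = 1) :
    ∑ k, (((√3 : ℝ) : ℂ) • (Matrix.diagonal q * shiftMatrix k)).conjTranspose *
      (((√3 : ℝ) : ℂ) • (Matrix.diagonal q * shiftMatrix k)) = ((3 : ℕ) : ℂ) • 1 := by
  have h3 : ((√3 : ℝ) : ℂ) * ((√3 : ℝ) : ℂ) = 3 := by norm_cast; simp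
  simp only [Fin.sum_univ_three] at hq
  simp at hq
  ext r s
  simp only [Matrix.conjTranspose_smul, Matrix.smul_mul, Matrix.mul_smul, smul_smul,
    Complex.star_def, Complex.conj_ofReal, h3]
  fin_cases r <;> fin_cases s <;>
    simp [Fin.sum_univ_three, Matrix.mul_apply, shiftMatrix, Matrix.diagonal_apply]
  all_goals linear_combination 3 * hq

theorem tri_diagonal_mul_shiftMatrix (q : Fin 3 → ℂ) (k : Fin 3) :
    tri (Matrix.diagonal q * shiftMatrix k) (shiftMatrix k) (shiftMatrix k) =
      tri (Matrix.diagonal q) 1 1 := by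
  ext ⟨x, y, z⟩
  fin_cases k <;> fin_cases x <;> fin_cases y <;> fin_cases z <;>
    simp [tri, shiftMatrix, Fin.sum_univ_three, Matrix.mul_apply, Matrix.diagonal_apply,
      Matrix.one_apply]

theorem ghz₃_eq_tri : ghz₃ = tri (d := 3) (((1 / √3 : ℝ) : ℂ) • 1) 1 1 := by
  ext ⟨i, j, k⟩
  simp [ghz₃, tri, ket, Matrix.one_apply]
  fin_cases i <;> fin_cases j <;> fin_cases k <;> simp

theorem locc_of_decomposition {u v : Fin 2 → ℂ} {V W U : Matrix (Fin 2) (Fin 2) ℂ} {q : Fin 3 → ℂ}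
    (hu : star u ⬝ᵥ u = 1) (hv : star v ⬝ᵥ v = 1) (hV : V.conjTranspose * V = 1)
    (hW : W.conjTranspose * W = 1) (hU : U.conjTranspose * U = 1)
    (hq : ∑ i, star (q i) * q i = 1) :
    LOCCConvertible ghz₃
      (tri (consCol u V * Matrix.diagonal q) (consCol v W) (U * mergeMatrix 0)) := by
  rw [ghz₃_eq_tri]
  refine .alice _ (sum_diagonal_mul_shiftMatrix hq) fun k => ?_
  refine .bob_unitary _ (shiftMatrix_conjTranspose_mul_self k) ?_
  refine .charlie_unitary _ (shiftMatrix_conjTranspose_mul_self k) ?_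
  have h1 : tri ((((√3 : ℝ) : ℂ) • (Matrix.diagonal q * shiftMatrix k)) *
      (((1 / √3 : ℝ) : ℂ) • 1)) (shiftMatrix k * 1) (shiftMatrix k * 1) =
      tri (Matrix.diagonal q) 1 1 := by
    have h3 : ((√3 : ℝ) : ℂ) * ((1 / √3 : ℝ) : ℂ) = 1 := by
      norm_cast
      simp
    rw [Matrix.mul_one, Matrix.mul_smul, Matrix.mul_one, smul_smul, mul_comm, h3, one_smul,
      tri_diagonal_mul_shiftMatrix]
  rw [h1]
  -- Outcome 1 puts a sign on the term `r = 2`, which Bob's `lastSign` removes.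
  refine .charlie mergeMatrix sum_mergeMatrix fun i => ?_
  refine .bob_unitary _ (lastSign_conjTranspose_mul_self i) ?_
  have h2 : tri (Matrix.diagonal q) (lastSign i * (1 : Matrix (Fin 3) (Fin 3) ℂ))
      (mergeMatrix i * (1 : Matrix (Fin 3) (Fin 3) ℂ)) =
      tri (Matrix.diagonal q) 1 (mergeMatrix 0) := by
    rw [Matrix.mul_one, Matrix.mul_one]
    ext ⟨x, y, z⟩
    fin_cases i <;> fin_cases y <;> fin_cases z <;>
      simp [tri, lastSign, mergeMatrix, Matrix.diagonal_apply, Matrix.one_apply]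
  rw [h2]
  -- Charlie's qubit is `|0⟩` exactly in the term `r = 0`, so `qubitSign` undoes the sign on the
  -- first column.
  refine .alice _ (sum_headSign_consCol hu hV) fun i => ?_
  refine .charlie_unitary _ (qubitSign_conjTranspose_mul_self i) ?_
  have h3 : tri (consCol u V * headSign i * Matrix.diagonal q) 1
      (qubitSign i * mergeMatrix 0) =
      tri (consCol u V * Matrix.diagonal q) (1 : Matrix (Fin 3) (Fin 3) ℂ) (mergeMatrix 0) := by
    ext ⟨x, y, z⟩
    fin_cases i <;> fin_cases y <;> fin_cases z <;>
      simp [tri, headSign, qubitSign, mergeMatrix, consCol, Matrix.one_apply]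
  rw [h3]
  refine .bob _ (sum_headSign_consCol hv hW) fun i => ?_
  refine .charlie_unitary _ (qubitSign_conjTranspose_mul_self i) ?_
  have h4 : tri (consCol u V * Matrix.diagonal q)
      (consCol v W * headSign i * (1 : Matrix (Fin 3) (Fin 3) ℂ))
      (qubitSign i * mergeMatrix 0) =
      tri (consCol u V * Matrix.diagonal q) (consCol v W) (mergeMatrix 0) := by
    rw [Matrix.mul_one]
    ext ⟨x, y, z⟩
    fin_cases i <;> fin_cases y <;> fin_cases z <;>
      simp [tri, Fin.sum_univ_three, headSign, qubitSign, mergeMatrix, consCol]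
  rw [h4]
  exact .charlie_unitary U hU (.refl _)

theorem sum_star_mul_self_eq_norm_sq {a b c : ℕ} (ψ : TriSpace a b c) :
    ∑ x, star (ψ x) * ψ x = ((‖ψ‖ ^ 2 : ℝ) : ℂ) := by
  rw [EuclideanSpace.norm_sq_eq]
  push_cast
  exact Finset.sum_congr rfl fun x _ => Complex.conj_mul' (ψ x)

theorem ghz₃_mem_pureStates : ghz₃ ∈ pureStates 3 3 3 := by
  have h := sum_star_mul_self_eq_norm_sq ghz₃
  have h3 : ((√3 : ℝ) : ℂ)⁻¹ * ((√3 : ℝ) : ℂ)⁻¹ = 3⁻¹ := by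
    rw [← mul_inv]
    norm_cast
    simp
  have h1 : ∑ x, star (ghz₃ x) * ghz₃ x = 1 := by
    rw [ghz₃_eq_tri, sum_star_tri_mul_tri]
    simp [Matrix.one_apply, h3]
  rw [h1] at h
  have h' : ‖ghz₃‖ ^ 2 = 1 := by exact_mod_cast h.symm
  exact (pow_eq_one_iff_of_nonneg (norm_nonneg _) two_ne_zero).1 h'

theorem theorem2 : IsCommonResource ghz₃ (pureStates 2 2 2) := by
  refine ⟨ghz₃_mem_pureStates, fun φ hφ => ?_⟩
  obtain ⟨u, v, V, W, U, q, hu, hv, hV, hW, hU, h⟩ := exists_consCol_decomposition φ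
  have hq := sum_star_consCol_decomposition q hu hv hV hW hU h
  rw [sum_star_mul_self_eq_norm_sq, show ‖φ‖ = 1 from hφ] at hq
  rw [h]
  exact locc_of_decomposition hu hv hV hW hU (by simpa using hq.symm)
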